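/- Let $\mathbb S^2=\{x\in\mathbb R^3:\|x\|_2=1\}$ with geodesic distance $d(x,y)=\arccos\langle x,y\rangle$. For every $x\in\mathbb S^2$ fix an orthonormal basis $\eta_1^x,\eta_2^x$ of the tangent plane $\{v:\langle x,v\rangle=0\}$ (no continuity in $x$ is required), and for $f:\mathbb S^2\to\mathbb R$ put $$X_kf(x)=\frac{d}{dt}\Big|_{t=0}f\big(\cos(t)\,x+\sin(t)\,\eta_k^x\big),\qquad k=1,2.$$ A superscript, as in $X_k^x$ or $X_k^y$, indicates the variable of a kernel on which the operator acts. For $N\in\mathbb N$ let $n=\lfloor N/2\rfloor$ and let $$J_N(x,y)=\frac{1}{(n+1)^4}\,\frac{\sin^4\big((n+1)d(x,y)/2\big)}{\sin^4\big(d(x,y)/2\big)},\qquad J_N(x,x)=1,$$ be the Jackson kernel. For points $x_1,\dots,x_M\in\mathbb S^2$ let $$K=\begin{pmatrix}J_N&X_1^xJ_N&X_2^xJ_N\\ X_1^yJ_N&X_1^xX_1^yJ_N&X_2^xX_1^yJ_N\\ X_2^yJ_N&X_1^xX_2^yJ_N&X_2^xX_2^yJ_N\end{pmatrix}\in\mathbb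 R^{3M\times 3M},$$ where each block stands for the matrix of the values of the kernel at $(x,y)=(x_i,x_j)$, $i,j=1,\dots,M$. Let $u\in\{-1,1\}^M$. For $\alpha=(\alpha_0,\alpha_1,\alpha_2)$ with $\alpha_k=(\alpha_{k,j})_{j=1}^M\in\mathbb R^M$ consider the linear system $K\alpha=(u,0,0)^{\mathrm T}$, and also the Hermite interpolation problem $q(x_i)=u_i$, $X_1q(x_i)=X_2q(x_i)=0$ $(i=1,\dots,M)$ for $$q(x)=\sum_{j=1}^M\alpha_{0,j}J_N(x,x_j)+\alpha_{1,j}X_1^yJ_N(x,x_j)+\alpha_{2,j}X_2^yJ_N(x,x_j)$$ (whose matrix is $K^{\mathrm T}$). Let $C_2=412.5\,\zeta(3)\,\pi^4$. (a) Let $N\ge 2$, and suppose that $d(x_i,x_j)\ge\frac{\nu}{n+1}$ for all $i\ne j$, where $\nu\ge0$ and $b\ge3$ are real numbers with $\nu^4\ge\frac{3}{0.99}\,b\,C_2$. Then $K$ is invertible, the linear system and the Hermite interpolation problem each have exactly one solution $\alpha$, and either solution satisfies $$\|\alpha_0\|_\infty\le1+\frac{1}{45(b-2)-1},\qquad \|\alpha_j\|_\infty\le\frac{(n+1)^{-1}}{4.5(b-2)-0.1}\quad(j=1,2),$$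 $$|\alpha_{0,i}|\ge1-\frac{1}{45(b-2)-1}\quad(i=1,\dots,M).$$ (b) Let $N\ge20$, and suppose that $d(x_i,x_j)\ge\frac{19.2\,\pi}{N}$ for all $i\ne j$. Then $K$ is invertible, the linear system and the Hermite interpolation problem each have exactly one solution $\alpha$, and either solution satisfies $$\|\alpha_0\|_\infty\le1+6.3\cdot10^{-3},\qquad \|\alpha_1\|_\infty,\ \|\alpha_2\|_\infty\le\frac{6.3\cdot10^{-2}}{n+1},\qquad |\alpha_{0,i}|\ge1-6.3\cdot10^{-3}\quad(i=1,\dots,M).$$ -/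

import Mathlib

open scoped BigOperators Matrix

noncomputable section

/-- Euclidean three-space. -/
abbrev E3 : Type := EuclideanSpace ℝ (Fin 3)

/-- The unit sphere in Euclidean three-space. -/
def S2 : Set E3 := Metric.sphere (0 : E3) 1

/-- The great-circle distance of two points of the unit sphere. -/
def geodesicDist (x y : E3) : ℝ := Real.arccos (inner ℝ x y)

/-- The geodesic of the sphere with starting point `x` and initial velocity `v`. -/
def geodesic (x v : E3) (t : ℝ) : E3 :=
  Real.cos (‖v‖ * t) • x + Real.sin (‖v‖ * t) • (‖v‖⁻¹ • v)

/-- `η x 0, η x 1` is an orthonormal basis of the tangent plane at `x`, for every point `x` of the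
sphere (no continuity in `x` is required). -/
def IsTangentFrame (η : E3 → Fin 2 → E3) : Prop :=
  ∀ x ∈ S2, Orthonormal ℝ (η x) ∧ ∀ k, inner ℝ x (η x k) = 0

/-- The differential operator in the direction of the `k`-th frame vector: the derivative at time
zero along the geodesic that leaves `x` in the direction `η x k`. For `x` on the sphere only the
values of `f` on the sphere matter, since the geodesic stays on it. -/
def sphDeriv (η : E3 → Fin 2 → E3) (k : Fin 2) (f : E3 → ℝ) (x : E3) : ℝ :=
  deriv (fun t : ℝ => f (geodesic x (η x k) t)) 0

/-- The operator `sphDeriv` acting on the first variable of a kernel. -/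
def sphDerivFst (η : E3 → Fin 2 → E3) (k : Fin 2) (J : E3 → E3 → ℝ) (x y : E3) : ℝ :=
  sphDeriv η k (fun z => J z y) x

/-- The operator `sphDeriv` acting on the second variable of a kernel. -/
def sphDerivSnd (η : E3 → Fin 2 → E3) (k : Fin 2) (J : E3 → E3 → ℝ) (x y : E3) : ℝ :=
  sphDeriv η k (fun z => J x z) y

/-- The Jackson trigonometric polynomial with `n = ⌊N / 2⌋`. Where the quotient reads `0 / 0` it
takes its limit `1`. -/
def jacksonTrig (N : ℕ) (ω : ℝ) : ℝ :=
  if Real.sin (ω / 2) = 0 then 1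
  else 1 / (((N / 2 : ℕ) : ℝ) + 1) ^ 4 *
    (Real.sin ((((N / 2 : ℕ) : ℝ) + 1) * ω / 2) ^ 4 / Real.sin (ω / 2) ^ 4)

/-- The Jackson kernel on the sphere. -/
def jacksonKernel (N : ℕ) (x y : E3) : ℝ := jacksonTrig N (geodesicDist x y)

/-- The matrix `(J (x i) (x j))` of a kernel on a family of points. -/
def kernelMatrix {M : ℕ} (x : Fin M → E3) (J : E3 → E3 → ℝ) : Matrix (Fin M) (Fin M) ℝ :=
  Matrix.of fun i j => J (x i) (x j)

/-- The interpolation matrix, with the three by three block structure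
```
J      X₁ˣ J      X₂ˣ J
X₁ʸ J  X₁ˣ X₁ʸ J  X₂ˣ X₁ʸ J
X₂ʸ J  X₁ˣ X₂ʸ J  X₂ˣ X₂ʸ J
```
for the Jackson kernel `J`. -/
def interpMatrix (η : E3 → Fin 2 → E3) (N : ℕ) {M : ℕ} (x : Fin M → E3) :
    Matrix (Fin M ⊕ (Fin M ⊕ Fin M)) (Fin M ⊕ (Fin M ⊕ Fin M)) ℝ :=
  Matrix.fromBlocks
    (kernelMatrix x (jacksonKernel N))
    (Matrix.fromCols
      (kernelMatrix x (sphDerivFst η 0 (jacksonKernel N)))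
      (kernelMatrix x (sphDerivFst η 1 (jacksonKernel N))))
    (Matrix.fromRows
      (kernelMatrix x (sphDerivSnd η 0 (jacksonKernel N)))
      (kernelMatrix x (sphDerivSnd η 1 (jacksonKernel N))))
    (Matrix.fromBlocks
      (kernelMatrix x (sphDerivFst η 0 (sphDerivSnd η 0 (jacksonKernel N))))
      (kernelMatrix x (sphDerivFst η 1 (sphDerivSnd η 0 (jacksonKernel N))))
      (kernelMatrix x (sphDerivFst η 0 (sphDerivSnd η 1 (jacksonKernel N))))
      (kernelMatrix x (sphDerivFst η 1 (sphDerivSnd η 1 (jacksonKernel N)))))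

/-- The coefficient vectors `α 0, α 1, α 2` solve the block system `K α = (u, 0, 0)`. -/
def SolvesSystem (η : E3 → Fin 2 → E3) (N : ℕ) {M : ℕ} (x : Fin M → E3) (u : Fin M → ℝ)
    (α : Fin 3 → Fin M → ℝ) : Prop :=
  interpMatrix η N x *ᵥ Sum.elim (α 0) (Sum.elim (α 1) (α 2)) = Sum.elim u 0

/-- The interpolant with coefficient vectors `α 0, α 1, α 2`. -/
def interpolant (η : E3 → Fin 2 → E3) (N : ℕ) {M : ℕ} (x : Fin M → E3)
    (α : Fin 3 → Fin M → ℝ) (z : E3) : ℝ :=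
  ∑ j, (α 0 j * jacksonKernel N z (x j)
    + α 1 j * sphDerivSnd η 0 (jacksonKernel N) z (x j)
    + α 2 j * sphDerivSnd η 1 (jacksonKernel N) z (x j))

/-- The interpolant with coefficients `α` solves the Hermite interpolation problem: it takes the
values `u i` at the points `x i`, and its first derivatives vanish there. -/
def SolvesHermite (η : E3 → Fin 2 → E3) (N : ℕ) {M : ℕ} (x : Fin M → E3) (u : Fin M → ℝ)
    (α : Fin 3 → Fin M → ℝ) : Prop :=
  ∀ i, interpolant η N x α (x i) = u i ∧ ∀ k, sphDeriv η k (interpolant η N x α) (x i) = 0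

/-- The points are pairwise at geodesic distance at least `δ`. -/
def IsSeparatedBy {M : ℕ} (x : Fin M → E3) (δ : ℝ) : Prop :=
  ∀ i j, i ≠ j → δ ≤ geodesicDist (x i) (x j)

/-- The constant `C₂ = 412.5 ζ(3) π⁴`. -/
def C2 : ℝ := 412.5 * (riemannZeta 3).re * Real.pi ^ 4

/-- The coefficient bounds; `‖·‖` on `Fin M → ℝ` is the maximum norm. -/
def CoeffBounds {M : ℕ} (A B : ℝ) (α : Fin 3 → Fin M → ℝ) : Prop :=
  ‖α 0‖ ≤ 1 + A ∧ ‖α 1‖ ≤ B ∧ ‖α 2‖ ≤ B ∧ ∀ i, 1 - A ≤ |α 0 i|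

end

/-!
Put `m = ⌊N / 2⌋ + 1`. On the sphere the Jackson kernel is a zonal polynomial,
`J (x, y) = p ⟨x, y⟩`, where `p = Q² / m⁴` and `(1 - X) Q = 1 - T m` for the Chebyshev polynomial
`T m` (`jacksonTrig_arccos`). Hence every entry of the interpolation matrix is a combination of `p`,
`p'`, `p''` at `⟨x, y⟩` with inner products of frame vectors, for instance
`X_k^x X_l^y J = p'' ⟨η_k, y⟩ ⟨x, η_l⟩ + p' ⟨η_k, η_l⟩`. The theorem follows because the matrix is
strongly dominated by its diagonal.

* Diagonal: the entries are `p(1) = 1`, `0` and `p'(1) = (m² - 1) / 3 ≥ m² / 4`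
  (`hermiteKernel_self`).
* Decay: differentiating `(1 - X) Q = 1 - T m` and using the Chebyshev differential equation,
  every off-diagonal entry is at most a small constant times `w = (m sin (ω / 2))⁻⁴`, and a factor
  `m` for each derivative (`jacksonPoly_bounds`, `abs_hermiteKernel_le`).
* Packing: `w` is `16 / (m |x - y|)⁴` in terms of the chord `|x - y|`. For points of
  three-space with mutual distances at least `q`, comparing volumes of balls and integrating the
  counting function gives `∑ |a|⁻⁴ ≤ 64 / q⁴` (`sum_inv_norm_pow_four_le`). With
  `q = 2 sin (δ / 2)` this bounds the row sums of `w` by `22.5 π⁴ / ν⁴`, where `δ = ν / m` is the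
  separation (`sum_weight_le`). Only `ζ(3) ≥ 1` is needed to compare this with the constant `C2`.
* Linear algebra: for row sums of `w` at most `σ ≤ 0.006`, the derivative rows give
  `m ‖α k‖ ≤ 8 σ ‖α 0‖`, and then the first rows give `|α 0 i - u i| ≤ 1.15 σ ‖α 0‖`
  (`IsNearDiagonal.bounds_of_blockMap_eq`). For zero data this is injectivity, and therefore
  invertibility; for data `±1` it yields the coefficient bounds.

The matrix of the Hermite problem arises from the interpolation matrix by interchanging the block
indices (`solvesHermite_iff`). The hypotheses of the last step are symmetric under this interchange,
so both systems are covered by the same argument.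
-/

/-! ### The Fejér and Jackson polynomials -/

open Polynomial in
/-- The Fejér polynomial: the quotient of `1 - T m` by `1 - X`, where `T m` is the Chebyshev
polynomial of the first kind. In the variable `cos ω` it is `sin² (m ω / 2) / sin² (ω / 2)`. -/
noncomputable def fejerPoly (m : ℕ) : ℝ[X] := (Chebyshev.T ℝ m - 1) /ₘ (X - C 1)

open Polynomial in
/-- The Jackson polynomial: the square of the Fejér polynomial, normalised to take the value `1`
at `1`. -/
noncomputable def jacksonPoly (m : ℕ) : ℝ[X] := C (1 / (m : ℝ) ^ 4) * fejerPoly m ^ 2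

open Polynomial in
theorem one_sub_X_mul_fejerPoly (m : ℕ) :
    (1 - X) * fejerPoly m = 1 - Chebyshev.T ℝ m := by
  have h : (X - C (1 : ℝ)) * fejerPoly m = Chebyshev.T ℝ m - 1 := by
    rw [fejerPoly, mul_divByMonic_eq_iff_isRoot]
    simp
  rw [map_one] at h
  linear_combination -h

open Polynomial in
theorem one_sub_mul_eval_fejerPoly (m : ℕ) (c : ℝ) :
    (1 - c) * (fejerPoly m).eval c = 1 - (Chebyshev.T ℝ m).eval c := by
  simpa using congrArg (eval c) (one_sub_X_mul_fejerPoly m)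

open Polynomial in
theorem one_sub_mul_eval_derivative_fejerPoly (m : ℕ) (c : ℝ) :
    (1 - c) * (derivative (fejerPoly m)).eval c
      = (fejerPoly m).eval c - (derivative (Chebyshev.T ℝ m)).eval c := by
  have h := congrArg (fun q => eval c (derivative q)) (one_sub_X_mul_fejerPoly m)
  simp only [derivative_mul, derivative_sub, derivative_one, derivative_X, eval_add, eval_mul,
    eval_sub, eval_one, eval_zero, eval_X] at h
  linarith

open Polynomial in
theorem one_sub_mul_eval_derivative_derivative_fejerPoly (m : ℕ) (c : ℝ) :
    (1 - c) * (derivative (derivative (fejerPoly m))).eval c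
      = 2 * (derivative (fejerPoly m)).eval c
        - (derivative (derivative (Chebyshev.T ℝ m))).eval c := by
  have h := congrArg (fun q => eval c (derivative (derivative q))) (one_sub_X_mul_fejerPoly m)
  simp only [derivative_mul, derivative_sub, derivative_one, derivative_X, derivative_add,
    derivative_zero, eval_add, eval_mul, eval_sub, eval_one, eval_zero, eval_X] at h
  linarith

open Polynomial in
theorem eval_one_derivative_derivative_T (m : ℕ) :
    (derivative (derivative (Chebyshev.T ℝ m))).eval 1 = (m : ℝ) ^ 2 * (m ^ 2 - 1) / 3 := by
  have h := Chebyshev.iterate_derivative_T_eval_one (R := ℝ) m 2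
  simp [Finset.prod_range_succ] at h
  linarith

open Polynomial in
theorem eval_one_fejerPoly (m : ℕ) : (fejerPoly m).eval 1 = (m : ℝ) ^ 2 := by
  have h := one_sub_mul_eval_derivative_fejerPoly m 1
  rw [Chebyshev.derivative_T_eval_one] at h
  push_cast at h
  linarith

open Polynomial in
theorem eval_one_derivative_fejerPoly (m : ℕ) :
    (derivative (fejerPoly m)).eval 1 = (m : ℝ) ^ 2 * (m ^ 2 - 1) / 6 := by
  have h := one_sub_mul_eval_derivative_derivative_fejerPoly m 1
  rw [eval_one_derivative_derivative_T] at h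
  linarith

open Polynomial in
theorem eval_jacksonPoly (m : ℕ) (c : ℝ) :
    (jacksonPoly m).eval c = (fejerPoly m).eval c ^ 2 / (m : ℝ) ^ 4 := by
  simp [jacksonPoly]; ring

open Polynomial in
theorem eval_derivative_jacksonPoly (m : ℕ) (c : ℝ) :
    (derivative (jacksonPoly m)).eval c
      = 2 * ((fejerPoly m).eval c * (derivative (fejerPoly m)).eval c) / (m : ℝ) ^ 4 := by
  simp [jacksonPoly, derivative_pow]; ring

open Polynomial in
theorem eval_derivative_derivative_jacksonPoly (m : ℕ) (c : ℝ) :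
    (derivative (derivative (jacksonPoly m))).eval c
      = 2 * ((derivative (fejerPoly m)).eval c ^ 2
        + (fejerPoly m).eval c * (derivative (derivative (fejerPoly m))).eval c) / (m : ℝ) ^ 4 := by
  simp [jacksonPoly, derivative_pow]; ring

open Polynomial in
theorem eval_one_jacksonPoly {m : ℕ} (hm : m ≠ 0) : (jacksonPoly m).eval 1 = 1 := by
  have : (m : ℝ) ≠ 0 := by exact_mod_cast hm
  rw [eval_jacksonPoly, eval_one_fejerPoly]
  field_simp

open Polynomial in
theorem eval_one_derivative_jacksonPoly {m : ℕ} (hm : m ≠ 0) :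
    (derivative (jacksonPoly m)).eval 1 = ((m : ℝ) ^ 2 - 1) / 3 := by
  have : (m : ℝ) ≠ 0 := by exact_mod_cast hm
  rw [eval_derivative_jacksonPoly, eval_one_fejerPoly, eval_one_derivative_fejerPoly]
  field_simp
  ring

open Polynomial in
theorem jacksonTrig_arccos (N : ℕ) {c : ℝ} (hc : |c| ≤ 1) :
    jacksonTrig N (Real.arccos c) = (jacksonPoly (N / 2 + 1)).eval c := by
  obtain ⟨h1, h2⟩ := abs_le.1 hc
  set ω := Real.arccos c with hω
  have hcos : Real.cos ω = c := Real.cos_arccos h1 h2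
  have hhalf : 1 - c = 2 * Real.sin (ω / 2) ^ 2 := by
    rw [← hcos, Real.sin_sq_eq_half_sub, show 2 * (ω / 2) = ω by ring]; ring
  unfold jacksonTrig
  split_ifs with hs
  · have : c = 1 := by rw [hs] at hhalf; linarith
    rw [this, eval_one_jacksonPoly (Nat.succ_ne_zero _)]
  · have hF := one_sub_mul_eval_fejerPoly (N / 2 + 1) c
    have hT : (Chebyshev.T ℝ ((N / 2 + 1 : ℕ) : ℤ)).eval c
        = Real.cos ((((N / 2 : ℕ) : ℝ) + 1) * ω) := by
      rw [← hcos, Chebyshev.T_real_cos, Int.cast_natCast, Nat.cast_succ]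
    have hm : 1 - Real.cos ((((N / 2 : ℕ) : ℝ) + 1) * ω)
        = 2 * Real.sin ((((N / 2 : ℕ) : ℝ) + 1) * ω / 2) ^ 2 := by
      rw [Real.sin_sq_eq_half_sub, mul_div_cancel₀ _ (two_ne_zero)]; ring
    rw [hT, hm, hhalf] at hF
    have hF' : (fejerPoly (N / 2 + 1)).eval c
        = Real.sin ((((N / 2 : ℕ) : ℝ) + 1) * ω / 2) ^ 2 / Real.sin (ω / 2) ^ 2 := by
      rw [eq_div_iff (by positivity)]; linarith
    rw [eval_jacksonPoly, hF']
    push_cast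
    field_simp

open Polynomial in
theorem abs_eval_derivative_T_le (m : ℕ) {c : ℝ} (hc : |c| ≤ 1) :
    |(derivative (Chebyshev.T ℝ m)).eval c| ≤ (m : ℝ) ^ 2 := by
  have h := Chebyshev.abs_iterate_derivative_T_real_le m 1 hc
  simpa [Chebyshev.derivative_T_eval_one] using h

open Polynomial in
theorem one_sub_sq_mul_eval_derivative_T_sq (m : ℕ) {c : ℝ} (hc : |c| ≤ 1) :
    (1 - c ^ 2) * (derivative (Chebyshev.T ℝ m)).eval c ^ 2
      = (m : ℝ) ^ 2 * (1 - (Chebyshev.T ℝ m).eval c ^ 2) := by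
  obtain ⟨h1, h2⟩ := abs_le.1 hc
  set ω := Real.arccos c with hω
  have hcos : Real.cos ω = c := Real.cos_arccos h1 h2
  have hU := Chebyshev.U_real_cos ω ((m : ℤ) - 1)
  rw [Chebyshev.T_derivative_eq_U, ← hcos, Chebyshev.T_real_cos, ← Real.sin_sq, ← Real.sin_sq]
  push_cast at hU ⊢
  rw [sub_add_cancel] at hU
  have hsq := congrArg (fun z => (m : ℝ) ^ 2 * z ^ 2) hU
  simp only [eval_mul, eval_natCast]
  linear_combination hsq

open Polynomial in
/-- The Chebyshev differential equation, evaluated at a point. -/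
theorem one_sub_sq_mul_eval_derivative_derivative_T (m : ℕ) (c : ℝ) :
    (1 - c ^ 2) * (derivative (derivative (Chebyshev.T ℝ m))).eval c
      = c * (derivative (Chebyshev.T ℝ m)).eval c - (m : ℝ) ^ 2 * (Chebyshev.T ℝ m).eval c := by
  simpa using congrArg (eval c)
    (Chebyshev.one_sub_X_sq_mul_derivative_derivative_T_eq_poly_in_T (R := ℝ) m)

open Polynomial in
/-- Decay of the Fejér polynomial and its derivatives away from `1`, with `r = √(1 - c²)`
playing the role of `sin ω`. The condition on `m² (1 - c)` makes the lower order terms small. -/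
theorem fejerPoly_bounds {m : ℕ} {c r : ℝ} (hc : |c| ≤ 1) (hr : 0 ≤ r) (hrc : r ^ 2 = 1 - c ^ 2)
    (hm : 100 ≤ (m : ℝ) ^ 2 * (1 - c)) :
    (1 - c) * |(fejerPoly m).eval c| ≤ 2 ∧
    (1 - c) * |(derivative (fejerPoly m)).eval c| ≤ 1.02 * m ^ 2 ∧
    r * ((1 - c) * |(derivative (fejerPoly m)).eval c|) ≤ 1.3 * m ∧
    r ^ 2 * ((1 - c) * |(derivative (derivative (fejerPoly m))).eval c|) ≤ 2.4 * m ^ 2 := by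
  obtain ⟨h1, h2⟩ := abs_le.1 hc
  have hQ := one_sub_mul_eval_fejerPoly m c
  have hQ1 := one_sub_mul_eval_derivative_fejerPoly m c
  have hQ2 := one_sub_mul_eval_derivative_derivative_fejerPoly m c
  have ht := Chebyshev.abs_eval_T_real_le_one m hc
  have ha := abs_eval_derivative_T_le m hc
  have hra := one_sub_sq_mul_eval_derivative_T_sq m hc
  have hode := one_sub_sq_mul_eval_derivative_derivative_T m c
  set Q := (fejerPoly m).eval c
  set Q' := (derivative (fejerPoly m)).eval c
  set Q'' := (derivative (derivative (fejerPoly m))).eval c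
  set t := (Chebyshev.T ℝ m).eval c
  set a := (derivative (Chebyshev.T ℝ m)).eval c
  set d := (derivative (derivative (Chebyshev.T ℝ m))).eval c
  set y := 1 - c with hy
  have hm0 : (0 : ℝ) ≤ m := Nat.cast_nonneg m
  have hypos : 0 < y := by
    by_contra hcon
    nlinarith [sq_nonneg (m : ℝ)]
  have hyQ : y * |Q| ≤ 2 := by
    have h3 : y * |Q| = |1 - t| := by rw [← hQ, abs_mul, abs_of_pos hypos]
    rw [h3]
    obtain ⟨h3, h4⟩ := abs_le.1 ht
    rw [abs_le]; constructor <;> linarith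
  have hQm : |Q| ≤ 0.02 * m ^ 2 := by
    refine le_of_mul_le_mul_left (hyQ.trans ?_) hypos
    linarith
  have hyQ' : y * |Q'| = |Q - a| := by
    rw [← hQ1, abs_mul, abs_of_pos hypos]
  have hQa : |Q - a| ≤ |Q| + |a| := abs_sub _ _
  -- `r² ≤ 2 y`, and `2 ≤ m² y / 50`
  have hrle : r ≤ 0.15 * (m * y) := by
    refine abs_le_of_sq_le_sq' ?_ (by positivity) |>.2
    have : r ^ 2 ≤ 2 * y := by rw [hrc]; nlinarith
    nlinarith
  have hra' : r * |a| ≤ m := by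
    refine abs_le_of_sq_le_sq' ?_ (by positivity) |>.2
    rw [mul_pow, hrc, sq_abs, hra]
    nlinarith [sq_nonneg t, sq_nonneg (m : ℝ)]
  have hr1 : r * (y * |Q'|) ≤ 1.3 * m := by
    have h5 : r * |Q| ≤ 0.3 * m := by
      calc r * |Q| ≤ 0.15 * (m * y) * |Q| := by gcongr
        _ = 0.15 * m * (y * |Q|) := by ring
        _ ≤ 0.15 * m * 2 := by gcongr
        _ = 0.3 * m := by ring
    rw [hyQ']
    nlinarith
  refine ⟨hyQ, by rw [hyQ']; linarith, hr1, ?_⟩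
  have hrQ' : r * (r * |Q'|) ≤ 0.15 * m * (1.3 * m) := by
    have h6 : r * (r * |Q'|) ≤ 0.15 * (m * y) * (r * |Q'|) := by gcongr
    have h7 : 0.15 * m * (r * (y * |Q'|)) ≤ 0.15 * m * (1.3 * m) := by gcongr
    linarith
  have hyQ'' : r ^ 2 * (y * |Q''|) = |2 * (r ^ 2 * Q') - (c * a - m ^ 2 * t)| := by
    rw [← hode, ← hrc, show 2 * (r ^ 2 * Q') - r ^ 2 * d = r ^ 2 * (2 * Q' - d) by ring, ← hQ2,
      abs_mul, abs_mul, abs_of_pos hypos, abs_of_nonneg (sq_nonneg r)]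
  have h8 : |c * a| ≤ m ^ 2 := by
    rw [abs_mul]
    calc |c| * |a| ≤ 1 * m ^ 2 := by gcongr
      _ = _ := one_mul _
  have h9 : |(m : ℝ) ^ 2 * t| ≤ m ^ 2 := by
    rw [abs_mul, abs_of_nonneg (sq_nonneg (m : ℝ))]
    calc (m : ℝ) ^ 2 * |t| ≤ m ^ 2 * 1 := by gcongr
      _ = _ := mul_one _
  have h10 : |2 * (r ^ 2 * Q')| = 2 * (r * (r * |Q'|)) := by
    rw [abs_mul, abs_mul, abs_of_nonneg (sq_nonneg r), abs_two]; ring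
  rw [hyQ'']
  have h11 := abs_sub (2 * (r ^ 2 * Q')) (c * a - m ^ 2 * t)
  have h12 := abs_sub (c * a) (m ^ 2 * t)
  nlinarith [sq_nonneg (m : ℝ)]

open Polynomial in
/-- Decay of the Jackson polynomial and its derivatives away from `1`: in terms of `c = cos ω` and
`r = sin ω`, all are controlled by the weight `4 / (m⁴ (1 - c)²) = (m sin (ω / 2))⁻⁴`. -/
theorem jacksonPoly_bounds {m : ℕ} {c r : ℝ} (hc : |c| ≤ 1) (hr : 0 ≤ r) (hrc : r ^ 2 = 1 - c ^ 2)
    (hm : 100 ≤ (m : ℝ) ^ 2 * (1 - c)) :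
    |(jacksonPoly m).eval c| ≤ 4 / (m ^ 4 * (1 - c) ^ 2) ∧
    |(derivative (jacksonPoly m)).eval c| * r ≤ 1.5 * m * (4 / (m ^ 4 * (1 - c) ^ 2)) ∧
    |(derivative (derivative (jacksonPoly m))).eval c| * r ^ 2
      + |(derivative (jacksonPoly m)).eval c| ≤ 5 * m ^ 2 * (4 / (m ^ 4 * (1 - c) ^ 2)) := by
  obtain ⟨b0, b1, b2, b3⟩ := fejerPoly_bounds hc hr hrc hm
  rw [eval_jacksonPoly, eval_derivative_jacksonPoly, eval_derivative_derivative_jacksonPoly]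
  set Q := (fejerPoly m).eval c
  set Q' := (derivative (fejerPoly m)).eval c
  set Q'' := (derivative (derivative (fejerPoly m))).eval c
  set y := 1 - c with hy
  have hm0 : (0 : ℝ) ≤ m := Nat.cast_nonneg m
  have hypos : 0 < y := by
    by_contra hcon
    nlinarith [sq_nonneg (m : ℝ)]
  have hmpos : (0 : ℝ) < m := by
    rcases hm0.eq_or_lt with h | h
    · rw [← h] at hm; norm_num at hm
    · exact h
  have hm4 : |(m : ℝ) ^ 4| = m ^ 4 := abs_of_pos (by positivity)
  have key : ∀ {z B : ℝ}, z * y ^ 2 ≤ B * 4 → z / m ^ 4 ≤ B * (4 / (m ^ 4 * y ^ 2)) := by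
    intro z B h
    rw [div_le_iff₀ (by positivity)]
    calc z ≤ B * 4 / y ^ 2 := by rw [le_div_iff₀ (by positivity)]; exact h
      _ = _ := by field_simp
  have n0 : 0 ≤ y * |Q| := by positivity
  have n1 : 0 ≤ y * |Q'| := by positivity
  have n2 : 0 ≤ y * |Q''| := by positivity
  refine ⟨?_, ?_, ?_⟩
  · rw [abs_div, hm4, abs_pow, ← one_mul (4 / _)]
    apply key
    nlinarith
  · rw [abs_div, hm4, abs_mul, abs_mul, abs_two, div_mul_eq_mul_div]
    apply key
    have := mul_le_mul b0 b2 (by positivity) (by norm_num)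
    nlinarith
  · rw [abs_div, abs_div, hm4, abs_mul, abs_mul _ (Q * Q'), abs_mul Q Q', abs_two,
      div_mul_eq_mul_div, ← add_div]
    apply key
    have e0 : |Q' ^ 2 + Q * Q''| ≤ |Q'| ^ 2 + |Q| * |Q''| := by
      refine (abs_add_le _ _).trans_eq ?_
      rw [abs_pow, abs_mul]
    have e1 : (r * (y * |Q'|)) ^ 2 ≤ (1.3 * m) ^ 2 := by gcongr
    have e2 := mul_le_mul b0 b3 (by positivity) (by norm_num)
    have e3 := mul_le_mul b0 b1 n1 (by norm_num)
    have e4 : |Q' ^ 2 + Q * Q''| * (r ^ 2 * y ^ 2) ≤ (|Q'| ^ 2 + |Q| * |Q''|) * (r ^ 2 * y ^ 2) := by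
      gcongr
    nlinarith [sq_nonneg (m : ℝ)]

/-! ### Packings in Euclidean space -/

open MeasureTheory Metric Module in
/-- A volume bound for packings: if balls of radius `r` around the points of `s` are disjoint and
all points lie in the ball of radius `t`, the small balls fit into the ball of radius `t + r`. -/
theorem card_mul_pow_le_of_separated {E : Type*} [NormedAddCommGroup E] [NormedSpace ℝ E]
    [FiniteDimensional ℝ E] (s : Finset E) {r t : ℝ} (hr : 0 < r) (ht : 0 ≤ t)
    (hs : ∀ a ∈ s, ‖a‖ ≤ t) (hsep : ∀ a ∈ s, ∀ b ∈ s, a ≠ b → 2 * r ≤ ‖a - b‖) :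
    (s.card : ℝ) * r ^ finrank ℝ E ≤ (t + r) ^ finrank ℝ E := by
  borelize E
  let μ : Measure E := Measure.addHaar
  have hR : 0 < t + r := by positivity
  have hdisj : Set.Pairwise (s : Set E) (Function.onFun Disjoint fun a => ball (a : E) r) := by
    intro a ha b hb hab
    apply ball_disjoint_ball
    rw [dist_eq_norm, ← two_mul]
    exact hsep a ha b hb hab
  have hsub : (⋃ a ∈ s, ball (a : E) r) ⊆ ball (0 : E) (t + r) := by
    refine Set.iUnion₂_subset fun a ha => ball_subset_ball' ?_
    rw [dist_zero_right]
    linarith [hs a ha]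
  have hvol : (s.card : ENNReal) * ENNReal.ofReal (r ^ finrank ℝ E) * μ (ball 0 1) ≤
      ENNReal.ofReal ((t + r) ^ finrank ℝ E) * μ (ball 0 1) :=
    calc
      (s.card : ENNReal) * ENNReal.ofReal (r ^ finrank ℝ E) * μ (ball 0 1)
          = μ (⋃ a ∈ s, ball (a : E) r) := by
        rw [measure_biUnion_finset hdisj fun a _ => measurableSet_ball]
        simp only [μ.addHaar_ball_of_pos _ hr, Finset.sum_const, nsmul_eq_mul, mul_assoc]
      _ ≤ μ (ball (0 : E) (t + r)) := measure_mono hsub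
      _ = ENNReal.ofReal ((t + r) ^ finrank ℝ E) * μ (ball 0 1) := by
        simp only [μ.addHaar_ball_of_pos _ hR]
  have h := (ENNReal.mul_le_mul_iff_left (measure_ball_pos _ _ zero_lt_one).ne'
    measure_ball_lt_top.ne).1 hvol
  have h' := ENNReal.toReal_le_of_le_ofReal (pow_nonneg hR.le _) h
  rwa [ENNReal.toReal_mul, ENNReal.toReal_natCast,
    ENNReal.toReal_ofReal (pow_nonneg hr.le _)] at h'

/-- Around a point of a packing of Euclidean three-space, moved to the origin, at most
`(t / r + 1) ^ 3 - 1` other points of the packing have distance at most `t`. -/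
theorem card_le_of_separated_of_norm_le (s : Finset E3) {r t : ℝ} (hr : 0 < r) (ht : 0 ≤ t)
    (hs : ∀ a ∈ s, ‖a‖ ≤ t) (hs0 : ∀ a ∈ s, 2 * r ≤ ‖a‖)
    (hsep : ∀ a ∈ s, ∀ b ∈ s, a ≠ b → 2 * r ≤ ‖a - b‖) :
    (s.card : ℝ) ≤ (t / r + 1) ^ 3 - 1 := by
  classical
  have h0 : (0 : E3) ∉ s := fun h => by
    have := hs0 0 h
    rw [norm_zero] at this
    linarith
  have h := card_mul_pow_le_of_separated (insert 0 s) hr ht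
    (by simpa [ht] using hs) (by
      intro a ha b hb hab
      rcases Finset.mem_insert.1 ha with rfl | ha <;> rcases Finset.mem_insert.1 hb with rfl | hb
      · exact absurd rfl hab
      · simpa using hs0 b hb
      · simpa using hs0 a ha
      · exact hsep a ha b hb hab)
  rw [Finset.card_insert_of_notMem h0, finrank_euclideanSpace_fin, ← le_div_iff₀ (by positivity),
    ← div_pow, add_div, div_self hr.ne'] at h
  push_cast at h
  linarith

open MeasureTheory Set in
theorem integral_Ioi_neg_pow {k : ℕ} (hk : 2 ≤ k) {c : ℝ} (hc : 0 < c) :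
    IntegrableOn (fun t : ℝ => (t ^ k)⁻¹) (Ioi c) ∧
      ∫ t in Ioi c, (t ^ k)⁻¹ = (c ^ (k - 1))⁻¹ / (k - 1) := by
  have hk' : (-(k : ℝ)) < -1 := by
    have : (2 : ℝ) ≤ k := by exact_mod_cast hk
    linarith
  have hcongr : EqOn (fun t : ℝ => t ^ (-(k : ℝ))) (fun t : ℝ => (t ^ k)⁻¹) (Ioi c) := by
    intro t ht
    have : 0 < t := hc.trans ht
    simp only
    rw [Real.rpow_neg this.le, Real.rpow_natCast]
  refine ⟨(integrableOn_Ioi_rpow_of_lt hk' hc).congr_fun hcongr measurableSet_Ioi, ?_⟩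
  rw [← setIntegral_congr_fun measurableSet_Ioi hcongr, integral_Ioi_rpow_of_lt hk' hc]
  obtain ⟨j, rfl⟩ : ∃ j, k = j + 1 := ⟨k - 1, by omega⟩
  have hj : (j : ℝ) ≠ 0 := by
    have : j ≠ 0 := by omega
    exact_mod_cast this
  rw [show -((j + 1 : ℕ) : ℝ) + 1 = -(j : ℝ) by push_cast; ring, Real.rpow_neg hc.le,
    Real.rpow_natCast]
  rw [Nat.add_sub_cancel, Nat.cast_succ, add_sub_cancel_right, neg_div_neg_eq]

open MeasureTheory Set in
/-- The layer-cake estimate: writing `‖a‖⁻⁴` as the integral of `4 t⁻⁵` over `t > ‖a‖` turns the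
sum over a packing into an integral of the counting function, which the volume bound controls. -/
theorem sum_inv_norm_pow_four_le (s : Finset E3) {q : ℝ} (hq : 0 < q)
    (hs0 : ∀ a ∈ s, q ≤ ‖a‖) (hsep : ∀ a ∈ s, ∀ b ∈ s, a ≠ b → q ≤ ‖a - b‖) :
    ∑ a ∈ s, (‖a‖ ^ 4)⁻¹ ≤ 64 / q ^ 4 := by
  classical
  have hI5 := integral_Ioi_neg_pow (k := 5) (by norm_num) hq
  have hI4 := integral_Ioi_neg_pow (k := 4) (by norm_num) hq
  have hI3 := integral_Ioi_neg_pow (k := 3) (by norm_num) hq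
  have hI2 := integral_Ioi_neg_pow (k := 2) (by norm_num) hq
  let g : E3 → ℝ → ℝ := fun a => (Ioi ‖a‖).indicator fun t => 4 * (t ^ 5)⁻¹
  have hgint : ∀ a ∈ s, IntegrableOn (g a) (Ioi q) := fun a _ =>
    (hI5.1.const_mul 4).indicator measurableSet_Ioi
  have hterm : ∀ a ∈ s, (‖a‖ ^ 4)⁻¹ = ∫ t in Ioi q, g a t := by
    intro a ha
    have hpos : 0 < ‖a‖ := hq.trans_le (hs0 a ha)
    simp only [g]
    rw [setIntegral_indicator measurableSet_Ioi, Ioi_inter_Ioi, sup_eq_right.2 (hs0 a ha),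
      integral_const_mul, (integral_Ioi_neg_pow (k := 5) (by norm_num) hpos).2]
    norm_num
    ring
  have hpt : ∀ t ∈ Ioi q, ∑ a ∈ s, g a t ≤
      (32 / q ^ 3) * (t ^ 2)⁻¹ + (48 / q ^ 2) * (t ^ 3)⁻¹ + (24 / q) * (t ^ 4)⁻¹ := by
    intro t ht
    have htpos : 0 < t := hq.trans ht
    have hcard := card_le_of_separated_of_norm_le (s.filter fun a => ‖a‖ < t) (r := q / 2)
      (by positivity) htpos.le (fun a ha => (Finset.mem_filter.1 ha).2.le)
      (fun a ha => by linarith [hs0 a (Finset.mem_filter.1 ha).1])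
      (fun a ha b hb hab => by
        linarith [hsep a (Finset.mem_filter.1 ha).1 b (Finset.mem_filter.1 hb).1 hab])
    have hsum : ∑ a ∈ s, g a t = ((s.filter fun a => ‖a‖ < t).card : ℝ) * (4 * (t ^ 5)⁻¹) := by
      simp only [g, indicator_apply, mem_Ioi]
      rw [← Finset.sum_filter, Finset.sum_const, nsmul_eq_mul]
    rw [hsum]
    calc ((s.filter fun a => ‖a‖ < t).card : ℝ) * (4 * (t ^ 5)⁻¹)
        ≤ ((t / (q / 2) + 1) ^ 3 - 1) * (4 * (t ^ 5)⁻¹) := by gcongr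
      _ = _ := by field_simp; ring
  have hint23 : IntegrableOn
      (fun t : ℝ => (32 / q ^ 3) * (t ^ 2)⁻¹ + (48 / q ^ 2) * (t ^ 3)⁻¹) (Ioi q) :=
    (hI2.1.const_mul _).add (hI3.1.const_mul _)
  have hint234 : IntegrableOn
      (fun t : ℝ => (32 / q ^ 3) * (t ^ 2)⁻¹ + (48 / q ^ 2) * (t ^ 3)⁻¹ + (24 / q) * (t ^ 4)⁻¹)
      (Ioi q) := hint23.add (hI4.1.const_mul _)
  calc ∑ a ∈ s, (‖a‖ ^ 4)⁻¹ = ∑ a ∈ s, ∫ t in Ioi q, g a t := Finset.sum_congr rfl hterm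
    _ = ∫ t in Ioi q, ∑ a ∈ s, g a t := (integral_finsetSum s hgint).symm
    _ ≤ ∫ t in Ioi q,
        ((32 / q ^ 3) * (t ^ 2)⁻¹ + (48 / q ^ 2) * (t ^ 3)⁻¹ + (24 / q) * (t ^ 4)⁻¹) :=
      setIntegral_mono_on (integrable_finsetSum s hgint)
        hint234 measurableSet_Ioi hpt
    _ = 64 / q ^ 4 := by
      rw [integral_add hint23 (hI4.1.const_mul _),
        integral_add (hI2.1.const_mul _) (hI3.1.const_mul _), integral_const_mul,
        integral_const_mul, integral_const_mul, hI2.2, hI3.2, hI4.2]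
      norm_num
      field_simp
      norm_num

/-! ### Separated points on the sphere -/

theorem norm_sub_sq_of_mem_S2 {x y : E3} (hx : x ∈ S2) (hy : y ∈ S2) :
    ‖x - y‖ ^ 2 = 2 * (1 - inner ℝ x y) := by
  have hx' : ‖x‖ = 1 := mem_sphere_zero_iff_norm.1 hx
  have hy' : ‖y‖ = 1 := mem_sphere_zero_iff_norm.1 hy
  rw [norm_sub_sq_real, hx', hy']; ring

theorem abs_inner_le_one_of_mem_S2 {x y : E3} (hx : x ∈ S2) (hy : y ∈ S2) :
    |(inner ℝ x y : ℝ)| ≤ 1 := by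
  have h := abs_real_inner_le_norm x y
  rwa [mem_sphere_zero_iff_norm.1 hx, mem_sphere_zero_iff_norm.1 hy, one_mul] at h

/-- The chord spanned by an arc of length at least `δ` is at least `2 sin (δ / 2)` long. -/
theorem two_sin_half_le_norm_sub {x y : E3} (hx : x ∈ S2) (hy : y ∈ S2) {δ : ℝ} (hδ : 0 ≤ δ)
    (h : δ ≤ geodesicDist x y) : 2 * Real.sin (δ / 2) ≤ ‖x - y‖ := by
  refine abs_le_of_sq_le_sq' ?_ (norm_nonneg _) |>.2
  obtain ⟨h1, h2⟩ := abs_le.1 (abs_inner_le_one_of_mem_S2 hx hy)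
  have hcos : (inner ℝ x y : ℝ) ≤ Real.cos δ := by
    rw [← Real.cos_arccos h1 h2]
    exact Real.cos_le_cos_of_nonneg_of_le_pi hδ (Real.arccos_le_pi _) h
  rw [norm_sub_sq_of_mem_S2 hx hy, mul_pow, Real.sin_sq_eq_half_sub,
    mul_div_cancel₀ _ (two_ne_zero)]
  linarith

open Real in
/-- Below `π / 3` the sine lies above its chord. -/
theorem mul_le_sin_of_le_pi_div_three {t : ℝ} (h0 : 0 ≤ t) (h1 : t ≤ π / 3) :
    3 * √3 / (2 * π) * t ≤ sin t := by
  have hπ := pi_pos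
  have ha : 0 ≤ 1 - t / (π / 3) := by rwa [sub_nonneg, div_le_one (by positivity)]
  have hb : 0 ≤ t / (π / 3) := by positivity
  have hmem : π / 3 ∈ Set.Icc 0 π := ⟨by positivity, by linarith⟩
  have hc := strictConcaveOn_sin_Icc.concaveOn.2 ⟨le_rfl, hπ.le⟩ hmem ha hb (by ring)
  simp only [smul_eq_mul, mul_zero, zero_add, sin_zero, sin_pi_div_three] at hc
  rw [div_mul_cancel₀ _ (by positivity)] at hc
  refine le_trans (le_of_eq ?_) hc
  field_simp

/-- At most two points of the sphere have pairwise distances larger than `2 π / 3`. -/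
theorem card_le_one_of_inner_lt {s : Finset E3} {x : E3} (hx : x ∈ S2) (hs : ∀ y ∈ s, y ∈ S2)
    (hxs : ∀ y ∈ s, (inner ℝ x y : ℝ) < -(1 / 2))
    (hsep : ∀ y ∈ s, ∀ z ∈ s, y ≠ z → (inner ℝ y z : ℝ) < -(1 / 2)) : s.card ≤ 1 := by
  rw [Finset.card_le_one]
  intro y hy z hz
  by_contra hyz
  have h0 : 0 ≤ ‖x + y + z‖ ^ 2 := sq_nonneg _
  rw [norm_add_sq_real, norm_add_sq_real, inner_add_left, mem_sphere_zero_iff_norm.1 hx,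
    mem_sphere_zero_iff_norm.1 (hs y hy), mem_sphere_zero_iff_norm.1 (hs z hz)] at h0
  linarith [hxs y hy, hxs z hz, hsep y hy z hz hyz]

open Real in
/-- The weights `(m sin (ω / 2))⁻⁴`, summed over the other points of a separated family. For
separations up to `2 π / 3` this is the packing estimate applied to the chords; beyond that there
is at most one other point. -/
theorem sum_weight_le {M : ℕ} {x : Fin M → E3} (hx : ∀ i, x i ∈ S2) {m δ : ℝ} (hm : 0 < m)
    (hδ : 0 < δ) (hsep : IsSeparatedBy x δ) (i : Fin M) :
    ∑ j ∈ Finset.univ.erase i, 4 / (m ^ 4 * (1 - inner ℝ (x i) (x j)) ^ 2)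
      ≤ 22.5 * π ^ 4 / (m * δ) ^ 4 := by
  classical
  have hπ := pi_pos
  rcases (Finset.univ.erase i).eq_empty_or_nonempty with he | ⟨j₀, hj₀⟩
  · rw [he, Finset.sum_empty]; positivity
  have hδπ : δ ≤ π :=
    (hsep i j₀ (Finset.ne_of_mem_erase hj₀).symm).trans (arccos_le_pi _)
  have hsinpos : 0 < 2 * sin (δ / 2) :=
    mul_pos two_pos (sin_pos_of_pos_of_lt_pi (by positivity) (by linarith))
  have hchord : ∀ j k, j ≠ k → 2 * sin (δ / 2) ≤ ‖x j - x k‖ := fun j k hjk =>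
    two_sin_half_le_norm_sub (hx j) (hx k) hδ.le (hsep j k hjk)
  have hterm : ∀ j, 4 / (m ^ 4 * (1 - inner ℝ (x i) (x j)) ^ 2)
      = 16 / m ^ 4 * (‖x j - x i‖ ^ 4)⁻¹ := by
    intro j
    rw [show ‖x j - x i‖ ^ 4 = (‖x j - x i‖ ^ 2) ^ 2 by ring, norm_sub_rev,
      norm_sub_sq_of_mem_S2 (hx i) (hx j), mul_pow, mul_inv]
    simp only [div_eq_mul_inv, mul_inv]
    ring
  have hinj : Function.Injective fun j => x j - x i := by
    intro j k hjk
    by_contra hne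
    have := hchord j k hne
    rw [sub_left_inj.1 hjk, sub_self, norm_zero] at this
    linarith
  simp only [hterm]
  rw [← Finset.mul_sum]
  rcases le_or_gt δ (2 * π / 3) with h | h
  · have hpack := sum_inv_norm_pow_four_le ((Finset.univ.erase i).image fun j => x j - x i) hsinpos
      (by
        intro a ha
        obtain ⟨j, hj, rfl⟩ := Finset.mem_image.1 ha
        exact hchord j i (Finset.ne_of_mem_erase hj))
      (by
        intro a ha b hb hab
        obtain ⟨j, hj, rfl⟩ := Finset.mem_image.1 ha
        obtain ⟨k, hk, rfl⟩ := Finset.mem_image.1 hb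
        rw [sub_sub_sub_cancel_right]
        exact hchord j k fun hjk => hab (by rw [hjk]))
    rw [Finset.sum_image hinj.injOn] at hpack
    -- the constant becomes `16 * 64 * (2 π / (3 √3))⁴ = 16384 / 729 π⁴ < 22.5 π⁴`
    have hq : 3 * √3 / (2 * π) * δ ≤ 2 * sin (δ / 2) := by
      have := mul_le_sin_of_le_pi_div_three (t := δ / 2) (by positivity) (by linarith)
      linarith
    have h3 : √3 ^ 4 = 9 := by
      rw [show (4 : ℕ) = 2 * 2 by norm_num, pow_mul, sq_sqrt (by norm_num)]; norm_num
    calc 16 / m ^ 4 * ∑ j ∈ Finset.univ.erase i, (‖x j - x i‖ ^ 4)⁻¹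
        ≤ 16 / m ^ 4 * (64 / (2 * sin (δ / 2)) ^ 4) := by gcongr
      _ ≤ 16 / m ^ 4 * (64 / (3 * √3 / (2 * π) * δ) ^ 4) := by gcongr
      _ = 16384 / 729 * π ^ 4 / (m * δ) ^ 4 := by
        rw [mul_pow _ δ, div_pow, mul_pow 3, h3]
        field_simp
        norm_num
      _ ≤ 22.5 * π ^ 4 / (m * δ) ^ 4 := by gcongr; norm_num
  · have hin : ∀ j k, j ≠ k → (inner ℝ (x j) (x k) : ℝ) < -(1 / 2) := by
      intro j k hjk
      obtain ⟨h1, h2⟩ := abs_le.1 (abs_inner_le_one_of_mem_S2 (hx j) (hx k))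
      have h23 : cos (2 * π / 3) = -(1 / 2) := by
        rw [show 2 * π / 3 = π - π / 3 by ring, cos_pi_sub, cos_pi_div_three]
      rw [← h23, ← cos_arccos h1 h2]
      exact cos_lt_cos_of_nonneg_of_le_pi (by positivity) (arccos_le_pi _)
        (h.trans_le (hsep j k hjk))
    have hxinj : Function.Injective x := fun j k hjk => hinj (by simp only [hjk])
    have hcard : (Finset.univ.erase i).card ≤ 1 := by
      rw [← Finset.card_image_of_injective _ hxinj]
      refine card_le_one_of_inner_lt (hx i) ?_ ?_ ?_
      · intro y hy
        obtain ⟨j, -, rfl⟩ := Finset.mem_image.1 hy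
        exact hx j
      · intro y hy
        obtain ⟨j, hj, rfl⟩ := Finset.mem_image.1 hy
        exact hin i j (Finset.ne_of_mem_erase hj).symm
      · intro y hy z hz hyz
        obtain ⟨j, -, rfl⟩ := Finset.mem_image.1 hy
        obtain ⟨k, -, rfl⟩ := Finset.mem_image.1 hz
        exact hin j k fun hjk => hyz (by rw [hjk])
    have hone : Finset.univ.erase i = {j₀} :=
      Finset.eq_singleton_iff_unique_mem.2 ⟨hj₀, fun k hk => Finset.card_le_one.1 hcard k hk j₀ hj₀⟩
    rw [hone, Finset.sum_singleton]
    have hq : 2 * (δ / π) ≤ 2 * sin (δ / 2) := by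
      have := mul_le_sin (x := δ / 2) (by positivity) (by linarith)
      linarith [show 2 / π * (δ / 2) = δ / π by field_simp]
    calc 16 / m ^ 4 * (‖x j₀ - x i‖ ^ 4)⁻¹ ≤ 16 / m ^ 4 * ((2 * (δ / π)) ^ 4)⁻¹ := by
          gcongr
          exact hq.trans (hchord j₀ i (Finset.ne_of_mem_erase hj₀))
      _ = 1 * π ^ 4 / (m * δ) ^ 4 := by
          field_simp
          norm_num
      _ ≤ 22.5 * π ^ 4 / (m * δ) ^ 4 := by gcongr; norm_num

/-! ### Geodesics and tangent frames -/

theorem geodesic_of_norm_eq_one {x v : E3} (hv : ‖v‖ = 1) (t : ℝ) :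
    geodesic x v t = Real.cos t • x + Real.sin t • v := by
  simp [geodesic, hv]

theorem geodesic_mem_S2 {x v : E3} (hx : x ∈ S2) (hv : ‖v‖ = 1) (hxv : inner ℝ x v = 0) (t : ℝ) :
    geodesic x v t ∈ S2 := by
  have hx' : ‖x‖ = 1 := mem_sphere_zero_iff_norm.1 hx
  have h : ‖geodesic x v t‖ ^ 2 = 1 := by
    rw [geodesic_of_norm_eq_one hv, norm_add_sq_real, norm_smul, norm_smul, inner_smul_left,
      inner_smul_right, hxv, hx', hv, mul_one, mul_one, Real.norm_eq_abs, Real.norm_eq_abs, sq_abs,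
      sq_abs]
    linarith [Real.sin_sq_add_cos_sq t]
  rw [S2, mem_sphere_zero_iff_norm]
  nlinarith [norm_nonneg (geodesic x v t)]

theorem geodesic_zero {x v : E3} : geodesic x v 0 = x := by
  simp [geodesic]

theorem hasDerivAt_inner_geodesic {x v : E3} (hv : ‖v‖ = 1) (y : E3) :
    HasDerivAt (fun t => (inner ℝ (geodesic x v t) y : ℝ)) (inner ℝ v y) 0 := by
  have h := ((Real.hasDerivAt_cos 0).mul_const (inner ℝ x y : ℝ)).add
    ((Real.hasDerivAt_sin 0).mul_const (inner ℝ v y : ℝ))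
  rw [Real.sin_zero, Real.cos_zero, neg_zero, zero_mul, zero_add, one_mul] at h
  refine h.congr_of_eventuallyEq (Filter.Eventually.of_forall fun t => ?_)
  simp [geodesic_of_norm_eq_one hv, inner_add_left, inner_smul_left]

namespace IsTangentFrame

variable {η : E3 → Fin 2 → E3} {x y : E3}

theorem norm_eq_one (hη : IsTangentFrame η) (hx : x ∈ S2) (k : Fin 2) : ‖η x k‖ = 1 :=
  (hη x hx).1.1 k

theorem inner_eq_zero (hη : IsTangentFrame η) (hx : x ∈ S2) (k : Fin 2) :
    inner ℝ x (η x k) = 0 :=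
  (hη x hx).2 k

theorem geodesic_mem (hη : IsTangentFrame η) (hx : x ∈ S2) (k : Fin 2) (t : ℝ) :
    geodesic x (η x k) t ∈ S2 :=
  geodesic_mem_S2 hx (hη.norm_eq_one hx k) (hη.inner_eq_zero hx k) t

/-- Bessel's inequality for the orthonormal pair `x, η x k` and the unit vector `y`. -/
theorem inner_sq_le (hη : IsTangentFrame η) (hx : x ∈ S2) (hy : y ∈ S2) (k : Fin 2) :
    (inner ℝ (η x k) y : ℝ) ^ 2 ≤ 1 - (inner ℝ x y : ℝ) ^ 2 := by
  have hx' : ‖x‖ = 1 := mem_sphere_zero_iff_norm.1 hx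
  have hy' : ‖y‖ = 1 := mem_sphere_zero_iff_norm.1 hy
  have h0 : 0 ≤ ‖y - ((inner ℝ x y : ℝ) • x + (inner ℝ (η x k) y : ℝ) • η x k)‖ ^ 2 := sq_nonneg _
  rw [norm_sub_sq_real, norm_add_sq_real, inner_add_right, inner_smul_right, inner_smul_right,
    inner_smul_left, inner_smul_right, hη.inner_eq_zero hx, norm_smul, norm_smul, hx', hy',
    hη.norm_eq_one hx, mul_one, mul_one, Real.norm_eq_abs, Real.norm_eq_abs, sq_abs, sq_abs,
    real_inner_comm x y, real_inner_comm (η x k) y] at h0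
  linarith

theorem abs_inner_frame_le (hη : IsTangentFrame η) (hx : x ∈ S2) (hy : y ∈ S2) (k l : Fin 2) :
    |(inner ℝ (η x k) (η y l) : ℝ)| ≤ 1 := by
  have h := abs_real_inner_le_norm (η x k) (η y l)
  rwa [hη.norm_eq_one hx, hη.norm_eq_one hy, one_mul] at h

end IsTangentFrame

theorem jacksonKernel_eq (N : ℕ) {x y : E3} (hx : x ∈ S2) (hy : y ∈ S2) :
    jacksonKernel N x y = (jacksonPoly (N / 2 + 1)).eval (inner ℝ x y) :=
  jacksonTrig_arccos N (abs_inner_le_one_of_mem_S2 hx hy)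

theorem jacksonKernel_comm (N : ℕ) (x y : E3) : jacksonKernel N x y = jacksonKernel N y x := by
  simp only [jacksonKernel, geodesicDist, real_inner_comm]

/-! ### Derivatives of the Jackson kernel -/

section Derivatives

variable {η : E3 → Fin 2 → E3} {x y : E3}

open Polynomial in
theorem hasDerivAt_jacksonKernel_geodesic (hη : IsTangentFrame η) (N : ℕ) (hx : x ∈ S2)
    (hy : y ∈ S2) (k : Fin 2) :
    HasDerivAt (fun t => jacksonKernel N (geodesic x (η x k) t) y)
      ((derivative (jacksonPoly (N / 2 + 1))).eval (inner ℝ x y) * inner ℝ (η x k) y) 0 := by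
  have h1 := hasDerivAt_inner_geodesic (x := x) (hη.norm_eq_one hx k) y
  have h2 := (jacksonPoly (N / 2 + 1)).hasDerivAt (inner ℝ (geodesic x (η x k) 0) y)
  have h3 := h2.comp 0 h1
  rw [geodesic_zero] at h3
  exact h3.congr_of_eventuallyEq
    (Filter.Eventually.of_forall fun t => jacksonKernel_eq N (hη.geodesic_mem hx k t) hy)

open Polynomial in
theorem sphDerivFst_jacksonKernel (hη : IsTangentFrame η) (N : ℕ) (hx : x ∈ S2) (hy : y ∈ S2)
    (k : Fin 2) :
    sphDerivFst η k (jacksonKernel N) x y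
      = (derivative (jacksonPoly (N / 2 + 1))).eval (inner ℝ x y) * inner ℝ (η x k) y :=
  (hasDerivAt_jacksonKernel_geodesic hη N hx hy k).deriv

open Polynomial in
theorem sphDerivSnd_jacksonKernel (hη : IsTangentFrame η) (N : ℕ) (hx : x ∈ S2) (hy : y ∈ S2)
    (k : Fin 2) :
    sphDerivSnd η k (jacksonKernel N) x y
      = (derivative (jacksonPoly (N / 2 + 1))).eval (inner ℝ x y) * inner ℝ x (η y k) := by
  have h := sphDerivFst_jacksonKernel hη N hy hx k
  rw [real_inner_comm x y, real_inner_comm x (η y k)] at h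
  rw [← h]
  simp only [sphDerivFst, sphDerivSnd, jacksonKernel_comm N x]

open Polynomial in
theorem hasDerivAt_sphDerivSnd_jacksonKernel_geodesic (hη : IsTangentFrame η) (N : ℕ)
    (hx : x ∈ S2) (hy : y ∈ S2) (k l : Fin 2) :
    HasDerivAt (fun t => sphDerivSnd η l (jacksonKernel N) (geodesic x (η x k) t) y)
      ((derivative (derivative (jacksonPoly (N / 2 + 1)))).eval (inner ℝ x y)
          * inner ℝ (η x k) y * inner ℝ x (η y l)
        + (derivative (jacksonPoly (N / 2 + 1))).eval (inner ℝ x y)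
          * inner ℝ (η x k) (η y l)) 0 := by
  have h1 := hasDerivAt_inner_geodesic (x := x) (hη.norm_eq_one hx k) y
  have h2 := (derivative (jacksonPoly (N / 2 + 1))).hasDerivAt
    (inner ℝ (geodesic x (η x k) 0) y)
  have h3 := (h2.comp 0 h1).mul
    (hasDerivAt_inner_geodesic (x := x) (hη.norm_eq_one hx k) (η y l))
  simp only [Function.comp_apply, geodesic_zero] at h3
  exact h3.congr_of_eventuallyEq (Filter.Eventually.of_forall fun t =>
    sphDerivSnd_jacksonKernel hη N (hη.geodesic_mem hx k t) hy l)

open Polynomial in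
theorem sphDerivFst_sphDerivSnd_jacksonKernel (hη : IsTangentFrame η) (N : ℕ) (hx : x ∈ S2)
    (hy : y ∈ S2) (k l : Fin 2) :
    sphDerivFst η k (sphDerivSnd η l (jacksonKernel N)) x y
      = (derivative (derivative (jacksonPoly (N / 2 + 1)))).eval (inner ℝ x y)
          * inner ℝ (η x k) y * inner ℝ x (η y l)
        + (derivative (jacksonPoly (N / 2 + 1))).eval (inner ℝ x y)
          * inner ℝ (η x k) (η y l) :=
  (hasDerivAt_sphDerivSnd_jacksonKernel_geodesic hη N hx hy k l).deriv

end Derivatives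

/-! ### Entries of the interpolation matrix -/

/-- The nine kernels of the interpolation problem: `l` tells the operator applied to the first
variable of the Jackson kernel and `k` that applied to the second, where the index `0` stands for
the identity and `1`, `2` for the two derivatives. -/
noncomputable def hermiteKernel (η : E3 → Fin 2 → E3) (N : ℕ) (k l : Fin 3) : E3 → E3 → ℝ :=
  Fin.cases id (sphDerivFst η) l
    (Fin.cases (jacksonKernel N) (fun k => sphDerivSnd η k (jacksonKernel N)) k)

/-- The order of growth in `m` of the coefficients: a derivative costs a factor `m`. -/
noncomputable def blockScale (m : ℝ) (k : Fin 3) : ℝ := if k = 0 then 1 else m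

/-- The constants that bound the off-diagonal entries of the blocks. -/
noncomputable def blockConst (k l : Fin 3) : ℝ :=
  if k = 0 then (if l = 0 then 1 else 1.5) else (if l = 0 then 1.5 else 5)

theorem blockConst_comm (k l : Fin 3) : blockConst k l = blockConst l k := by
  unfold blockConst; split_ifs <;> rfl

/-- The value of the kernel block `(k, k)` on the diagonal, which is `1` for the Jackson kernel and
its second derivative `(m² - 1) / 3` otherwise. -/
noncomputable def blockDiag (m : ℝ) (k : Fin 3) : ℝ := if k = 0 then 1 else (m ^ 2 - 1) / 3

section Kernels

variable {η : E3 → Fin 2 → E3} {x y : E3}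

theorem hermiteKernel_self (hη : IsTangentFrame η) (N : ℕ) (hx : x ∈ S2) (k l : Fin 3) :
    hermiteKernel η N k l x x = if k = l then blockDiag ((N / 2 : ℕ) + 1) k else 0 := by
  have hxx : (inner ℝ x x : ℝ) = 1 := by
    rw [real_inner_self_eq_norm_sq, mem_sphere_zero_iff_norm.1 hx, one_pow]
  have hm : N / 2 + 1 ≠ 0 := Nat.succ_ne_zero _
  have h0 : ∀ k, (inner ℝ (η x k) x : ℝ) = 0 := fun k => by
    rw [real_inner_comm, hη.inner_eq_zero hx]
  refine Fin.cases ?_ (fun k => ?_) k <;> refine Fin.cases ?_ (fun l => ?_) l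
  · have hJ : jacksonKernel N x x = 1 := by
      rw [jacksonKernel_eq N hx hx, hxx, eval_one_jacksonPoly hm]
    simp [hermiteKernel, blockDiag, hJ]
  · simp [hermiteKernel, sphDerivFst_jacksonKernel hη N hx hx, h0, (Fin.succ_ne_zero l).symm]
  · simp [hermiteKernel, sphDerivSnd_jacksonKernel hη N hx hx, hη.inner_eq_zero hx]
  · have horth := (orthonormal_iff_ite.1 (hη x hx).1) l k
    simp only [hermiteKernel, Fin.cases_succ, sphDerivFst_sphDerivSnd_jacksonKernel hη N hx hx,
      h0, hxx, eval_one_derivative_jacksonPoly hm, horth, Fin.succ_inj, blockDiag,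
      Fin.succ_ne_zero, if_false, eq_comm (a := l)]
    split_ifs <;> simp

theorem abs_hermiteKernel_le (hη : IsTangentFrame η) (N : ℕ) (hx : x ∈ S2) (hy : y ∈ S2)
    (hm : 100 ≤ (((N / 2 : ℕ) : ℝ) + 1) ^ 2 * (1 - inner ℝ x y)) (k l : Fin 3) :
    |hermiteKernel η N k l x y| ≤
      blockConst k l * (blockScale ((N / 2 : ℕ) + 1) k * blockScale ((N / 2 : ℕ) + 1) l)
        * (4 / ((((N / 2 : ℕ) : ℝ) + 1) ^ 4 * (1 - inner ℝ x y) ^ 2)) := by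
  have hc := abs_inner_le_one_of_mem_S2 hx hy
  have hcsq : 0 ≤ 1 - (inner ℝ x y : ℝ) ^ 2 := by
    rw [sub_nonneg, sq_le_one_iff_abs_le_one]; exact hc
  have hb := jacksonPoly_bounds (m := N / 2 + 1) hc (Real.sqrt_nonneg _) (Real.sq_sqrt hcsq)
    (by push_cast; exact hm)
  push_cast at hb
  obtain ⟨b0, b1, b2⟩ := hb
  have hfst : ∀ k, |(inner ℝ (η x k) y : ℝ)| ≤ √(1 - (inner ℝ x y : ℝ) ^ 2) := fun k =>
    Real.abs_le_sqrt (hη.inner_sq_le hx hy k)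
  have hsnd : ∀ k, |(inner ℝ x (η y k) : ℝ)| ≤ √(1 - (inner ℝ x y : ℝ) ^ 2) := fun k => by
    rw [← real_inner_comm x (η y k), ← real_inner_comm x y]
    exact Real.abs_le_sqrt (hη.inner_sq_le hy hx k)
  refine Fin.cases ?_ (fun k => ?_) k <;> refine Fin.cases ?_ (fun l => ?_) l
  · simpa [hermiteKernel, blockConst, blockScale, jacksonKernel_eq N hx hy] using b0
  · simp only [hermiteKernel, Fin.cases_succ, Fin.cases_zero, blockConst, blockScale,
      Fin.succ_ne_zero, if_true, if_false, sphDerivFst_jacksonKernel hη N hx hy, abs_mul, one_mul]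
    exact (mul_le_mul_of_nonneg_left (hfst l) (abs_nonneg _)).trans b1
  · simp only [hermiteKernel, Fin.cases_succ, Fin.cases_zero, blockConst, blockScale, id,
      Fin.succ_ne_zero, if_true, if_false, sphDerivSnd_jacksonKernel hη N hx hy, abs_mul, mul_one]
    exact (mul_le_mul_of_nonneg_left (hsnd k) (abs_nonneg _)).trans b1
  · simp only [hermiteKernel, Fin.cases_succ, blockConst, blockScale,
      Fin.succ_ne_zero, if_false, sphDerivFst_sphDerivSnd_jacksonKernel hη N hx hy, ← sq]
    refine (abs_add_le _ _).trans (le_trans ?_ b2)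
    rw [abs_mul, abs_mul, abs_mul, mul_assoc, sq (√_)]
    gcongr
    · exact hfst l
    · exact hsnd k
    · exact mul_le_of_le_one_right (abs_nonneg _) (hη.abs_inner_frame_le hx hy l k)

end Kernels

/-! ### Near-diagonal block systems -/

section BlockSystem

variable {M : ℕ}

/-- A block matrix is near-diagonal if it has the diagonal of the interpolation matrix and its
off-diagonal entries are bounded, up to constants and powers of the scale `m`, by weights whose row
sums are at most `σ`. -/
structure IsNearDiagonal (T : Fin 3 → Fin 3 → Fin M → Fin M → ℝ) (m σ : ℝ) : Prop where
  diag : ∀ k l i, T k l i i = if k = l then blockDiag m k else 0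
  off_diag : ∃ w : Fin M → Fin M → ℝ,
    (∀ k l i j, i ≠ j →
      |T k l i j| ≤ blockConst k l * (blockScale m k * blockScale m l) * w i j) ∧
    ∀ i, ∑ j ∈ Finset.univ.erase i, w i j ≤ σ

/-- The linear map of a block matrix, acting on triples of coefficient vectors. -/
def blockMap (T : Fin 3 → Fin 3 → Fin M → Fin M → ℝ) :
    (Fin 3 → Fin M → ℝ) →ₗ[ℝ] (Fin 3 → Fin M → ℝ) where
  toFun α := fun k i => ∑ l, ∑ j, T k l i j * α l j
  map_add' α β := by
    ext k i
    simp only [Pi.add_apply, mul_add, Finset.sum_add_distrib]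
  map_smul' c α := by
    ext k i
    simp only [Pi.smul_apply, smul_eq_mul, Finset.mul_sum, RingHom.id_apply, mul_left_comm c]

theorem blockMap_apply (T : Fin 3 → Fin 3 → Fin M → Fin M → ℝ) (α : Fin 3 → Fin M → ℝ) (k : Fin 3)
    (i : Fin M) : blockMap T α k i = ∑ l, ∑ j, T k l i j * α l j := rfl

namespace IsNearDiagonal

variable {T : Fin 3 → Fin 3 → Fin M → Fin M → ℝ} {m σ : ℝ}

theorem swap (hT : IsNearDiagonal T m σ) : IsNearDiagonal (fun k l => T l k) m σ where
  diag k l i := by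
    rw [hT.diag]
    by_cases h : k = l
    · rw [h]
    · rw [if_neg h, if_neg (Ne.symm h)]
  off_diag := by
    obtain ⟨w, hw, hσ⟩ := hT.off_diag
    refine ⟨w, fun k l i j hij => ?_, hσ⟩
    rw [blockConst_comm, mul_comm (blockScale m k)]
    exact hw l k i j hij

theorem abs_blockMap_sub_le (hT : IsNearDiagonal T m σ) (hm : 0 ≤ m) (α : Fin 3 → Fin M → ℝ)
    (k : Fin 3) (i : Fin M) :
    |blockMap T α k i - blockDiag m k * α k i|
      ≤ σ * (blockScale m k * ∑ l, blockConst k l * (blockScale m l * ‖α l‖)) := by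
  obtain ⟨w, hw, hσ⟩ := hT.off_diag
  have hC : ∀ l, 0 ≤ blockConst k l := fun l => by
    unfold blockConst; split_ifs <;> norm_num
  have hs : ∀ l, 0 ≤ blockScale m l := fun l => by
    unfold blockScale; split_ifs <;> linarith
  have hsplit : blockMap T α k i - blockDiag m k * α k i
      = ∑ l, ∑ j ∈ Finset.univ.erase i, T k l i j * α l j := by
    rw [blockMap_apply, sub_eq_iff_eq_add]
    have : ∀ l, ∑ j, T k l i j * α l j
        = ∑ j ∈ Finset.univ.erase i, T k l i j * α l j
          + if k = l then blockDiag m k * α l i else 0 := fun l => by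
      rw [← Finset.sum_erase_add _ _ (Finset.mem_univ i), hT.diag, ite_mul, zero_mul]
    simp only [this, Finset.sum_add_distrib, Finset.sum_ite_eq, Finset.mem_univ, if_true]
  rw [hsplit]
  calc |∑ l, ∑ j ∈ Finset.univ.erase i, T k l i j * α l j|
      ≤ ∑ l, ∑ j ∈ Finset.univ.erase i, |T k l i j * α l j| :=
        (Finset.abs_sum_le_sum_abs _ _).trans
          (Finset.sum_le_sum fun l _ => Finset.abs_sum_le_sum_abs _ _)
    _ ≤ ∑ l, ∑ j ∈ Finset.univ.erase i,
        (blockConst k l * (blockScale m k * blockScale m l) * ‖α l‖) * w i j := by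
        refine Finset.sum_le_sum fun l _ => Finset.sum_le_sum fun j hj => ?_
        have hij := hw k l i j (Finset.ne_of_mem_erase hj).symm
        rw [abs_mul, mul_right_comm]
        exact mul_le_mul hij (norm_le_pi_norm (α l) j) (abs_nonneg _)
          ((abs_nonneg _).trans hij)
    _ ≤ ∑ l, (blockConst k l * (blockScale m k * blockScale m l) * ‖α l‖) * σ := by
        refine Finset.sum_le_sum fun l _ => ?_
        rw [← Finset.mul_sum]
        exact mul_le_mul_of_nonneg_left (hσ i)
          (mul_nonneg (mul_nonneg (hC l) (mul_nonneg (hs k) (hs l))) (norm_nonneg _))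
    _ = _ := by
        rw [Finset.mul_sum, Finset.mul_sum]
        refine Finset.sum_congr rfl fun l _ => ?_
        ring

/-- The Neumann-type a priori estimate. The derivative rows, whose diagonal is at least `m² / 4`,
bound the derivative coefficients by `‖α 0‖`; substituted into the first rows, this bounds the
deviation of `α 0` from the data. -/
theorem bounds_of_blockMap_eq (hT : IsNearDiagonal T m σ) (hm : 2 ≤ m) (hσ0 : 0 ≤ σ)
    (hσ : σ ≤ 0.006) {α : Fin 3 → Fin M → ℝ} {u : Fin M → ℝ} (h : blockMap T α = ![u, 0, 0]) :
    (∀ i, |α 0 i - u i| ≤ 1.15 * σ * ‖α 0‖) ∧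
      m * ‖α 1‖ ≤ 8 * σ * ‖α 0‖ ∧ m * ‖α 2‖ ≤ 8 * σ * ‖α 0‖ := by
  have hm0 : 0 < m := by linarith
  have hrow : ∀ k : Fin 3, k ≠ 0 → m * ‖α k‖
      ≤ 4 * σ * (1.5 * ‖α 0‖ + 5 * (m * ‖α 1‖ + m * ‖α 2‖)) := by
    intro k hk
    have hu : (![u, 0, 0] : Fin 3 → Fin M → ℝ) k = 0 := by
      fin_cases k
      · exact absurd rfl hk
      · rfl
      · rfl
    rw [mul_comm, ← le_div_iff₀ hm0, pi_norm_le_iff_of_nonneg (by positivity)]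
    intro i
    have hi := hT.abs_blockMap_sub_le hm0.le α k i
    rw [h, hu, Pi.zero_apply, zero_sub, abs_neg, abs_mul] at hi
    simp only [Fin.sum_univ_three, blockDiag, blockConst, blockScale, hk, if_false, if_true,
      one_mul, Fin.reduceEq] at hi
    rw [abs_of_nonneg (by nlinarith : 0 ≤ (m ^ 2 - 1) / 3)] at hi
    rw [le_div_iff₀ hm0, Real.norm_eq_abs]
    have h4 : m * (m * |α k i|) ≤ 4 * ((m ^ 2 - 1) / 3 * |α k i|) := by
      have : m * m ≤ 4 * ((m ^ 2 - 1) / 3) := by nlinarith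
      calc m * (m * |α k i|) = m * m * |α k i| := by ring
        _ ≤ 4 * ((m ^ 2 - 1) / 3) * |α k i| := by gcongr
        _ = _ := by ring
    refine le_of_mul_le_mul_left ?_ hm0
    calc m * (|α k i| * m) = m * (m * |α k i|) := by ring
      _ ≤ 4 * ((m ^ 2 - 1) / 3 * |α k i|) := h4
      _ ≤ 4 * (σ * (m * (1.5 * ‖α 0‖ + 5 * (m * ‖α 1‖) + 5 * (m * ‖α 2‖)))) := by gcongr
      _ = _ := by ring
  have h1 := hrow 1 (by decide)
  have h2 := hrow 2 (by decide)
  have n0 := norm_nonneg (α 0)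
  have n1 : 0 ≤ m * ‖α 1‖ := by positivity
  have n2 : 0 ≤ m * ‖α 2‖ := by positivity
  have hσ3 : σ * (m * ‖α 1‖ + m * ‖α 2‖) ≤ 0.006 * (m * ‖α 1‖ + m * ‖α 2‖) := by gcongr
  have hsum : m * ‖α 1‖ + m * ‖α 2‖ ≤ 15.8 * (σ * ‖α 0‖) := by
    have : 0 ≤ σ * ‖α 0‖ := by positivity
    nlinarith
  have hσ0' : σ * (σ * ‖α 0‖) ≤ 0.006 * (σ * ‖α 0‖) := by gcongr
  have hσsum : σ * (m * ‖α 1‖ + m * ‖α 2‖) ≤ σ * (15.8 * (σ * ‖α 0‖)) := by gcongr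
  refine ⟨fun i => ?_, by nlinarith, by nlinarith⟩
  have hi := hT.abs_blockMap_sub_le hm0.le α 0 i
  rw [h, abs_sub_comm] at hi
  simp only [Fin.sum_univ_three, blockDiag, blockConst, blockScale, if_false, if_true,
    one_mul, Fin.reduceEq, Matrix.cons_val_zero] at hi
  nlinarith

theorem blockMap_bijective (hT : IsNearDiagonal T m σ) (hm : 2 ≤ m) (hσ0 : 0 ≤ σ)
    (hσ : σ ≤ 0.006) : Function.Bijective (blockMap T) := by
  have hinj : Function.Injective (blockMap T) := by
    rw [injective_iff_map_eq_zero]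
    intro α hα
    obtain ⟨h0, h1, h2⟩ := hT.bounds_of_blockMap_eq hm hσ0 hσ (u := 0) (α := α) (by
      rw [hα]; ext k i; fin_cases k <;> rfl)
    have hα0 : ‖α 0‖ = 0 := by
      have h3 : ‖α 0‖ ≤ 1.15 * σ * ‖α 0‖ := by
        rw [pi_norm_le_iff_of_nonneg (by positivity)]
        intro i
        simpa using h0 i
      nlinarith [norm_nonneg (α 0)]
    rw [hα0, mul_zero] at h1 h2
    have hα1 : ‖α 1‖ = 0 := by nlinarith [norm_nonneg (α 1)]
    have hα2 : ‖α 2‖ = 0 := by nlinarith [norm_nonneg (α 2)]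
    ext k i
    fin_cases k
    · exact congrFun (norm_eq_zero.1 hα0) i
    · exact congrFun (norm_eq_zero.1 hα1) i
    · exact congrFun (norm_eq_zero.1 hα2) i
  exact ⟨hinj, LinearMap.injective_iff_surjective.1 hinj⟩

theorem coeffBounds (hT : IsNearDiagonal T m σ) (hm : 2 ≤ m) (hσ0 : 0 ≤ σ) (hσ : σ ≤ 0.006)
    {α : Fin 3 → Fin M → ℝ} {u : Fin M → ℝ} (hu : ∀ i, u i = 1 ∨ u i = -1)
    (h : blockMap T α = ![u, 0, 0]) {A B : ℝ} (hA : 1.15 * σ / (1 - 1.15 * σ) ≤ A)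
    (hB : 8 * σ / (1 - 1.15 * σ) ≤ m * B) : CoeffBounds A B α := by
  obtain ⟨h0, h1, h2⟩ := hT.bounds_of_blockMap_eq hm hσ0 hσ h
  have hm0 : 0 < m := by linarith
  have he : 0 < 1 - 1.15 * σ := by linarith
  have hu1 : ∀ i, |u i| = 1 := fun i => by rcases hu i with h | h <;> simp [h]
  have hα0 : ‖α 0‖ ≤ 1 / (1 - 1.15 * σ) := by
    have h3 : ‖α 0‖ ≤ 1 + 1.15 * σ * ‖α 0‖ := by
      rw [pi_norm_le_iff_of_nonneg (by positivity)]
      intro i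
      have := abs_sub_abs_le_abs_sub (α 0 i) (u i)
      rw [hu1 i] at this
      rw [Real.norm_eq_abs]
      linarith [h0 i]
    rw [le_div_iff₀ he]
    linarith
  have heA : 1.15 * σ * ‖α 0‖ ≤ A := by
    calc 1.15 * σ * ‖α 0‖ ≤ 1.15 * σ * (1 / (1 - 1.15 * σ)) := by gcongr
      _ = 1.15 * σ / (1 - 1.15 * σ) := by ring
      _ ≤ A := hA
  have heB : 8 * σ * ‖α 0‖ ≤ m * B := by
    calc 8 * σ * ‖α 0‖ ≤ 8 * σ * (1 / (1 - 1.15 * σ)) := by gcongr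
      _ = 8 * σ / (1 - 1.15 * σ) := by ring
      _ ≤ m * B := hB
  refine ⟨?_, le_of_mul_le_mul_left (h1.trans heB) hm0, le_of_mul_le_mul_left (h2.trans heB) hm0,
    fun i => ?_⟩
  · have hone : 1 / (1 - 1.15 * σ) = 1 + 1.15 * σ / (1 - 1.15 * σ) := by field_simp; ring
    linarith
  · have := abs_sub_abs_le_abs_sub (u i) (α 0 i)
    rw [hu1 i, abs_sub_comm] at this
    linarith [h0 i]

end IsNearDiagonal

end BlockSystem

/-! ### The interpolation matrix and the Hermite problem -/

section Systems

variable {η : E3 → Fin 2 → E3} {N M : ℕ} {x : Fin M → E3}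

/-- The blocks of the interpolation matrix. -/
noncomputable def hermiteBlocks (η : E3 → Fin 2 → E3) (N : ℕ) (x : Fin M → E3)
    (k l : Fin 3) (i j : Fin M) : ℝ := hermiteKernel η N k l (x i) (x j)

theorem interpMatrix_mulVec (α : Fin 3 → Fin M → ℝ) :
    interpMatrix η N x *ᵥ Sum.elim (α 0) (Sum.elim (α 1) (α 2))
      = Sum.elim (blockMap (hermiteBlocks η N x) α 0)
        (Sum.elim (blockMap (hermiteBlocks η N x) α 1) (blockMap (hermiteBlocks η N x) α 2)) := by
  ext (i | i | i) <;>
  · simp only [interpMatrix, Matrix.mulVec, dotProduct, Fintype.sum_sum_type, Sum.elim_inl,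
      Sum.elim_inr, Matrix.fromBlocks_apply₁₁, Matrix.fromBlocks_apply₁₂,
      Matrix.fromBlocks_apply₂₁, Matrix.fromBlocks_apply₂₂, Matrix.fromCols_apply_inl,
      Matrix.fromCols_apply_inr, Matrix.fromRows_apply_inl, Matrix.fromRows_apply_inr,
      blockMap_apply, Fin.sum_univ_three, ← add_assoc]
    rfl

theorem solvesSystem_iff (u : Fin M → ℝ) (α : Fin 3 → Fin M → ℝ) :
    SolvesSystem η N x u α ↔ blockMap (hermiteBlocks η N x) α = ![u, 0, 0] := by
  unfold SolvesSystem
  rw [interpMatrix_mulVec, Sum.elim_eq_iff, ← Sum.elim_zero_zero, Sum.elim_eq_iff]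
  constructor
  · rintro ⟨h0, h1, h2⟩
    ext k i
    fin_cases k
    · exact congrFun h0 i
    · exact congrFun h1 i
    · exact congrFun h2 i
  · intro h
    exact ⟨congrFun h 0, congrFun h 1, congrFun h 2⟩

theorem sphDeriv_interpolant (hη : IsTangentFrame η) (hx : ∀ i, x i ∈ S2) (α : Fin 3 → Fin M → ℝ)
    (i : Fin M) (k : Fin 2) :
    sphDeriv η k (interpolant η N x α) (x i)
      = ∑ j, (α 0 j * sphDerivFst η k (jacksonKernel N) (x i) (x j)
        + α 1 j * sphDerivFst η k (sphDerivSnd η 0 (jacksonKernel N)) (x i) (x j)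
        + α 2 j * sphDerivFst η k (sphDerivSnd η 1 (jacksonKernel N)) (x i) (x j)) := by
  have h0 : ∀ j, HasDerivAt (fun t => jacksonKernel N (geodesic (x i) (η (x i) k) t) (x j))
      (sphDerivFst η k (jacksonKernel N) (x i) (x j)) 0 := fun j =>
    (hasDerivAt_jacksonKernel_geodesic hη N (hx i) (hx j) k).differentiableAt.hasDerivAt
  have h1 : ∀ l j, HasDerivAt
      (fun t => sphDerivSnd η l (jacksonKernel N) (geodesic (x i) (η (x i) k) t) (x j))
      (sphDerivFst η k (sphDerivSnd η l (jacksonKernel N)) (x i) (x j)) 0 := fun l j =>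
    (hasDerivAt_sphDerivSnd_jacksonKernel_geodesic hη N
      (hx i) (hx j) k l).differentiableAt.hasDerivAt
  exact (HasDerivAt.fun_sum fun j _ => (((h0 j).const_mul (α 0 j)).add
    ((h1 0 j).const_mul (α 1 j))).add ((h1 1 j).const_mul (α 2 j))).deriv

/-- In the Hermite interpolation problem, differentiation acts on the first variable and the
index of the coefficient belongs to the second; its matrix therefore arises from the
interpolation matrix by interchanging the block indices. -/
theorem solvesHermite_iff (hη : IsTangentFrame η) (hx : ∀ i, x i ∈ S2) (u : Fin M → ℝ)
    (α : Fin 3 → Fin M → ℝ) :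
    SolvesHermite η N x u α ↔ blockMap (fun k l => hermiteBlocks η N x l k) α = ![u, 0, 0] := by
  have hval : ∀ i, interpolant η N x α (x i)
      = blockMap (fun k l => hermiteBlocks η N x l k) α 0 i := by
    intro i
    rw [blockMap_apply, Fin.sum_univ_three, ← Finset.sum_add_distrib, ← Finset.sum_add_distrib]
    refine Finset.sum_congr rfl fun j _ => ?_
    rw [mul_comm (α 0 j), mul_comm (α 1 j), mul_comm (α 2 j)]
    rfl
  have hder : ∀ k i, sphDeriv η k (interpolant η N x α) (x i)
      = blockMap (fun k l => hermiteBlocks η N x l k) α k.succ i := by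
    intro k i
    rw [sphDeriv_interpolant hη hx, blockMap_apply, Fin.sum_univ_three, ← Finset.sum_add_distrib,
      ← Finset.sum_add_distrib]
    refine Finset.sum_congr rfl fun j _ => ?_
    rw [mul_comm (α 0 j), mul_comm (α 1 j), mul_comm (α 2 j)]
    rfl
  unfold SolvesHermite
  constructor
  · intro h
    ext k i
    fin_cases k
    · exact (hval i).symm.trans (h i).1
    · exact (hder 0 i).symm.trans ((h i).2 0)
    · exact (hder 1 i).symm.trans ((h i).2 1)
  · intro h i
    refine ⟨(hval i).trans (congrFun (congrFun h 0) i), fun k => (hder k i).trans ?_⟩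
    rw [h]
    fin_cases k <;> rfl

/-- For points so well separated that the scaled separation `ν = (⌊N / 2⌋ + 1) δ` is at least `24`, the
blocks are near-diagonal. -/
theorem isNearDiagonal_hermiteBlocks (hη : IsTangentFrame η) (hx : ∀ i, x i ∈ S2) {ν : ℝ}
    (hν : 24 ≤ ν) (hsep : IsSeparatedBy x (ν / (((N / 2 : ℕ) : ℝ) + 1))) :
    IsNearDiagonal (hermiteBlocks η N x) (((N / 2 : ℕ) : ℝ) + 1)
      (22.5 * Real.pi ^ 4 / ν ^ 4) where
  diag k l i := hermiteKernel_self hη N (hx i) k l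
  off_diag := by
    have hm : (0 : ℝ) < ((N / 2 : ℕ) : ℝ) + 1 := by positivity
    set m : ℝ := ((N / 2 : ℕ) : ℝ) + 1 with hmdef
    have hδ : 0 < ν / m := by positivity
    refine ⟨fun i j => 4 / (m ^ 4 * (1 - inner ℝ (x i) (x j)) ^ 2), fun k l i j hij => ?_,
      fun i => ?_⟩
    · refine abs_hermiteKernel_le hη N (hx i) (hx j) ?_ k l
      have hdist := hsep i j hij
      have hπ : ν / m ≤ Real.pi := hdist.trans (Real.arccos_le_pi _)
      have hsin := Real.mul_le_sin (x := ν / m / 2) (by positivity) (by linarith)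
      have hchord := two_sin_half_le_norm_sub (hx i) (hx j) hδ.le hdist
      -- the chord is at least `2 ν / (π m) ≥ 15 / m`
      have h15 : 15 / m ≤ ‖x i - x j‖ := by
        refine le_trans ?_ ((mul_le_mul_of_nonneg_left hsin two_pos.le).trans hchord)
        rw [show 2 * (2 / Real.pi * (ν / m / 2)) = 2 * ν / Real.pi / m by field_simp]
        gcongr
        rw [le_div_iff₀ Real.pi_pos]
        linarith [Real.pi_lt_d2]
      have hsq : (15 / m) ^ 2 ≤ ‖x i - x j‖ ^ 2 := by gcongr
      rw [norm_sub_sq_of_mem_S2 (hx i) (hx j), div_pow, div_le_iff₀ (by positivity)] at hsq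
      linarith
    · have h := sum_weight_le hx hm hδ hsep i
      rwa [mul_div_cancel₀ _ hm.ne'] at h

/-- Existence, uniqueness and coefficient bounds, for a general scaled separation `ν`. -/
theorem interpolation_of_isSeparatedBy (hη : IsTangentFrame η) (hx : ∀ i, x i ∈ S2) (hN : 2 ≤ N)
    {ν A B σ : ℝ} (hν : 24 ≤ ν) (hsep : IsSeparatedBy x (ν / (((N / 2 : ℕ) : ℝ) + 1)))
    (hνσ : 22.5 * Real.pi ^ 4 / ν ^ 4 ≤ σ) (hσ : σ ≤ 0.006)
    (hA : 1.15 * σ / (1 - 1.15 * σ) ≤ A)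
    (hB : 8 * σ / (1 - 1.15 * σ) ≤ (((N / 2 : ℕ) : ℝ) + 1) * B) :
    IsUnit (interpMatrix η N x) ∧
      ∀ u : Fin M → ℝ, (∀ i, u i = 1 ∨ u i = -1) →
        (∃! α, SolvesSystem η N x u α) ∧
        (∃! α, SolvesHermite η N x u α) ∧
        ∀ α, SolvesSystem η N x u α ∨ SolvesHermite η N x u α → CoeffBounds A B α := by
  have hσ0 : 0 ≤ σ := le_trans (by positivity) hνσ
  have hm : (2 : ℝ) ≤ ((N / 2 : ℕ) : ℝ) + 1 := by
    have : 1 ≤ N / 2 := by omega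
    have : (1 : ℝ) ≤ ((N / 2 : ℕ) : ℝ) := by exact_mod_cast this
    linarith
  have hT : IsNearDiagonal (hermiteBlocks η N x) (((N / 2 : ℕ) : ℝ) + 1) σ := by
    have h := isNearDiagonal_hermiteBlocks (N := N) hη hx hν hsep
    obtain ⟨w, hw, hws⟩ := h.off_diag
    exact ⟨h.diag, w, hw, fun i => (hws i).trans hνσ⟩
  have hbij := hT.blockMap_bijective hm hσ0 hσ
  refine ⟨?_, fun u hu => ⟨?_, ?_, ?_⟩⟩
  · rw [← Matrix.mulVec_injective_iff_isUnit, ← Matrix.coe_mulVecLin, injective_iff_map_eq_zero]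
    intro v hv
    have hsplit : Sum.elim (![v ∘ Sum.inl, v ∘ Sum.inr ∘ Sum.inl, v ∘ Sum.inr ∘ Sum.inr] 0)
        (Sum.elim (![v ∘ Sum.inl, v ∘ Sum.inr ∘ Sum.inl, v ∘ Sum.inr ∘ Sum.inr] 1)
          (![v ∘ Sum.inl, v ∘ Sum.inr ∘ Sum.inl, v ∘ Sum.inr ∘ Sum.inr] 2)) = v := by
      ext (i | i | i) <;> rfl
    have hsys : SolvesSystem η N x 0
        ![v ∘ Sum.inl, v ∘ Sum.inr ∘ Sum.inl, v ∘ Sum.inr ∘ Sum.inr] := by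
      unfold SolvesSystem
      rw [hsplit, Sum.elim_zero_zero]
      exact hv
    rw [solvesSystem_iff] at hsys
    have hzero := hbij.1 (hsys.trans (by
      rw [map_zero]; ext k i; fin_cases k <;> rfl : _ = blockMap (hermiteBlocks η N x) 0))
    rw [← hsplit, hzero]
    ext (i | i | i) <;> rfl
  · simp only [solvesSystem_iff]
    exact hbij.existsUnique _
  · simp only [solvesHermite_iff hη hx]
    exact (hT.swap.blockMap_bijective hm hσ0 hσ).existsUnique _
  · rintro α (h | h)
    · exact hT.coeffBounds hm hσ0 hσ hu ((solvesSystem_iff u α).1 h) hA hB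
    · exact hT.swap.coeffBounds hm hσ0 hσ hu ((solvesHermite_iff hη hx u α).1 h) hA hB

end Systems

/-! ### The constants -/

theorem one_le_re_riemannZeta_three : 1 ≤ (riemannZeta 3).re := by
  have h : riemannZeta 3 = ((∑' n : ℕ, 1 / (n : ℝ) ^ 3 : ℝ) : ℂ) := by
    have := zeta_nat_eq_tsum_of_gt_one (k := 3) (by norm_num)
    push_cast at this ⊢
    exact this
  rw [h, Complex.ofReal_re]
  have hs : Summable fun n : ℕ => 1 / (n : ℝ) ^ 3 :=
    Real.summable_one_div_nat_pow.2 (by norm_num)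
  simpa using hs.le_tsum 1 fun n _ => by positivity

theorem le_C2 : 412.5 * Real.pi ^ 4 ≤ C2 := by
  have hπ : 0 ≤ Real.pi ^ 4 := by positivity
  unfold C2
  nlinarith [one_le_re_riemannZeta_three]

theorem mainTheorem3 (η : E3 → Fin 2 → E3) (hη : IsTangentFrame η)
    (N M : ℕ) (x : Fin M → E3) (hx : ∀ i, x i ∈ S2) :
    (2 ≤ N → ∀ ν b : ℝ, 0 ≤ ν → 3 ≤ b → 3 / 0.99 * b * C2 ≤ ν ^ 4 →
      IsSeparatedBy x (ν / (((N / 2 : ℕ) : ℝ) + 1)) →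
      IsUnit (interpMatrix η N x) ∧
      ∀ u : Fin M → ℝ, (∀ i, u i = 1 ∨ u i = -1) →
        (∃! α, SolvesSystem η N x u α) ∧
        (∃! α, SolvesHermite η N x u α) ∧
        ∀ α, SolvesSystem η N x u α ∨ SolvesHermite η N x u α →
          CoeffBounds (1 / (45 * (b - 2) - 1))
            ((((N / 2 : ℕ) : ℝ) + 1)⁻¹ / (4.5 * (b - 2) - 0.1)) α) ∧
    (20 ≤ N → IsSeparatedBy x (19.2 * Real.pi / N) →
      IsUnit (interpMatrix η N x) ∧
      ∀ u : Fin M → ℝ, (∀ i, u i = 1 ∨ u i = -1) →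
        (∃! α, SolvesSystem η N x u α) ∧
        (∃! α, SolvesHermite η N x u α) ∧
        ∀ α, SolvesSystem η N x u α ∨ SolvesHermite η N x u α →
          CoeffBounds 6.3e-3 (6.3e-2 / (((N / 2 : ℕ) : ℝ) + 1)) α) := by
  have hm : (0 : ℝ) < ((N / 2 : ℕ) : ℝ) + 1 := by positivity
  have hπ := Real.pi_gt_three
  constructor
  · intro hN ν b hν hb hνb hsep
    have hb0 : 0 < b := by linarith
    have hνb' : 1250 * b * Real.pi ^ 4 ≤ ν ^ 4 := by
      refine le_trans ?_ hνb
      calc 1250 * b * Real.pi ^ 4 = 3 / 0.99 * b * (412.5 * Real.pi ^ 4) := by ring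
        _ ≤ _ := by gcongr; exact le_C2
    have hν24 : 24 ≤ ν := by
      refine le_of_pow_le_pow_left₀ (n := 4) (by norm_num) hν (le_trans ?_ hνb')
      -- `π⁴ > 97`
      have h4 : (3.14 : ℝ) ^ 4 ≤ Real.pi ^ 4 := by
        gcongr
        exact Real.pi_gt_d2.le
      calc (24 : ℝ) ^ 4 ≤ 1250 * 3 * 3.14 ^ 4 := by norm_num
        _ ≤ 1250 * b * Real.pi ^ 4 := by gcongr
    -- `22.5 / 1250 = 0.018`
    refine interpolation_of_isSeparatedBy hη hx hN hν24 hsep (σ := 0.018 / b) ?_ ?_ ?_ ?_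
    · rw [div_le_div_iff₀ (by positivity) hb0]
      linarith
    · rw [div_le_iff₀ hb0]
      linarith
    · have : 1.15 * (0.018 / b) / (1 - 1.15 * (0.018 / b)) = 0.0207 / (b - 0.0207) := by
        field_simp
        norm_num
      rw [this, div_le_div_iff₀ (by linarith) (by linarith)]
      linarith
    · have : 8 * (0.018 / b) / (1 - 1.15 * (0.018 / b)) = 0.144 / (b - 0.0207) := by
        field_simp
        norm_num
      rw [this, mul_div_assoc', mul_inv_cancel₀ hm.ne', div_le_div_iff₀ (by linarith) (by linarith)]
      linarith
  · intro hN hsep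
    have hN0 : (0 : ℝ) < N := by
      have : 0 < N := by omega
      exact_mod_cast this
    refine interpolation_of_isSeparatedBy hη hx (by omega) (ν := 9.6 * Real.pi) (σ := 0.003)
      (by linarith) (fun i j hij => le_trans ?_ (hsep i j hij)) ?_ (by norm_num) (by norm_num) ?_
    · -- `N ≤ 2 (⌊N / 2⌋ + 1)`, so the scaled separation is at least `9.6 π`
      have hN2 : (N : ℝ) ≤ 2 * (((N / 2 : ℕ) : ℝ) + 1) := by
        have : N ≤ 2 * (N / 2 + 1) := by omega
        exact_mod_cast this
      rw [div_le_div_iff₀ hm hN0]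
      nlinarith
    · rw [mul_pow, mul_div_mul_right _ _ (by positivity)]
      norm_num
    · rw [mul_div_cancel₀ _ hm.ne']
      norm_num
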